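/- Let $\Lambda\subseteq\mathbb R$ and let $L_1,L_2,\dots$ be i.i.d. random functions $L_i:\Lambda\to\mathbb R$, not necessarily monotone, which almost surely are right-continuous on $\Lambda$ and satisfy $b\le L_i(\lambda)\le B$ for all $\lambda\in\Lambda$, where $b,B\in\mathbb R$ are constants. Let $\alpha\in\mathbb R$. For $n\ge 1$ and $\lambda\in\Lambda$ put $$\widehat R_n(\lambda)=\frac1n\sum_{i=1}^n L_i(\lambda),\qquad \widehat R_n^{\uparrow}(\lambda)=\sup_{t\in\Lambda,\ t\ge\lambda}\widehat R_n(t),\qquad \hat\lambda_n^{\uparrow}=\inf\{\lambda\in\Lambda:\widehat R_n^{\uparrow}(\lambda)\le\alpha\}.$$ Assume that for all sufficiently large $n$ the threshold $\hat\lambda_n^{\uparrow}$ is almost surely well-defined, that is, the set $\{\lambda\in\Lambda:\widehat R_n^{\uparrow}(\lambda)\le\alpha\}$ is nonempty and bounded below and its infimum belongs to $\Lambda$. Then, for all sufficiently large $n$, $L_{n+1}(\hat\lambda_n^{\uparrow})$ is integrable, and $$\limsup_{n\to\infty}\ \mathbb E\big[L_{n+1}(\hat\lambda_n^{\uparrow})\big]\le\alpha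 .$$ -/

import Mathlib

open MeasureTheory ProbabilityTheory Filter Set

namespace RiskControl

noncomputable section

/-- The empirical risk of the first `n` losses at the parameter `t`. The losses are indexed from
`0`, so the calibration losses are `L 0, …, L (n - 1)` and the test loss is `L n`. -/
def empRisk {Ω : Type*} (L : ℕ → ℝ → Ω → ℝ) (n : ℕ) (t : ℝ) (ω : Ω) : ℝ :=
  (∑ i ∈ Finset.range n, L i t ω) / n

/-- The monotonized empirical risk: the supremum of the empirical risk over the parameters
`t ∈ Λ` with `t ≥ lam`. -/
def monoEmpRisk {Ω : Type*} (Λ : Set ℝ) (L : ℕ → ℝ → Ω → ℝ) (n : ℕ) (lam : ℝ) (ω : Ω) : ℝ :=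
  sSup ((fun t => empRisk L n t ω) '' (Λ ∩ Ici lam))

/-- The parameters in `Λ` whose monotonized empirical risk is at most `α`. -/
def feasible {Ω : Type*} (Λ : Set ℝ) (L : ℕ → ℝ → Ω → ℝ) (α : ℝ) (n : ℕ) (ω : Ω) : Set ℝ :=
  {lam | lam ∈ Λ ∧ monoEmpRisk Λ L n lam ω ≤ α}

/-- The threshold chosen from the first `n` losses: the infimum of the feasible parameters. -/
def threshold {Ω : Type*} (Λ : Set ℝ) (L : ℕ → ℝ → Ω → ℝ) (α : ℝ) (n : ℕ) (ω : Ω) : ℝ :=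
  sInf (feasible Λ L α n ω)

/-- The threshold is well-defined as an element of `Λ`: the infimum is that of a nonempty set of
reals which is bounded below, and it lies in `Λ`. If `Λ` is closed and bounded below, this says
only that some parameter is feasible. -/
def ThresholdWellDefined {Ω : Type*} (Λ : Set ℝ) (L : ℕ → ℝ → Ω → ℝ) (α : ℝ) (n : ℕ) (ω : Ω) :
    Prop :=
  (feasible Λ L α n ω).Nonempty ∧ BddBelow (feasible Λ L α n ω) ∧ threshold Λ L α n ω ∈ Λ

end

end RiskControl

/-!
Write `R t` for the common expectation of the losses at `t` and `T n` for the threshold computed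
from the first `n` losses. The argument rests on three facts.

* By right-continuity the empirical risk is at most `α` at every parameter `t ≥ T n`, the threshold
  included (`empRisk_le_of_threshold_le`).
* The test loss is independent of the threshold, so the expected test loss at `T n` is the
  expectation of `R (T n)` (`integral_eval_of_indepFun`). Measurability is the delicate point, as
  `Λ` is an arbitrary set of reals. Since `Λ` is separable for the topology of
  right-neighbourhoods, right-continuity reduces all suprema, infima and evaluations to a countable
  set of parameters (`exists_measurable_eval`, `exists_measurable_threshold`).
* The probability that `R (T n) > α + ε` tends to `0` (`measure_threshold_risky_le`). A uniform law
  of large numbers over `Λ` is false for general right-continuous losses, but a one-sided bound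
  suffices. Let `S` be the set of parameters with `R t > α + ε`, and let `u` be an increasing
  sequence in `S` that eventually passes every element of `S`. If `T n` lies in `S`, then it is at
  most `u k` for all large `k`, so that the empirical risk at `u k` is at most `α`. By Chebyshev's
  inequality this has probability `O(1 / (n * ε ^ 2))` uniformly in `k`, and the events `T n ∈ S`,
  `T n ≤ u k` increase to `T n ∈ S`, so the bound persists in the limit.

As `R` is bounded, the expectation of `R (T n)` is at most `α + ε + O(1 / n)` for each fixed `ε`.
-/

open scoped Topology

namespace RiskControl

/-! ### Right-dense sequences and measurable evaluation -/

/-- Every nonempty set of reals is separable for the topology of right-neighbourhoods. -/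
theorem exists_seq_dense_right {S : Set ℝ} (hS : S.Nonempty) :
    ∃ d : ℕ → S, ∀ t ∈ S, ∀ ε > 0, ∃ m, t ≤ (d m : ℝ) ∧ (d m : ℝ) < t + ε := by
  obtain ⟨D, hDS, hDc, hD⟩ :=
    (TopologicalSpace.IsSeparable.of_separableSpace S).exists_countable_dense_subset
  -- The points of `S` that are isolated on the right escape an ordinary dense subset.
  set I : Set ℝ := {x ∈ S | 𝓝[S ∩ Ioi x] x = ⊥}
  have hIc : I.Countable := countable_setOfPred_isolated_right_within
  have key : ∀ t ∈ S, ∀ ε > 0, ∃ x ∈ D ∪ I, t ≤ x ∧ x < t + ε := by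
    intro t ht ε hε
    by_cases hI : t ∈ I
    · exact ⟨t, Or.inr hI, le_rfl, by linarith⟩
    · have hne : (𝓝[S ∩ Ioi t] t).NeBot := ⟨fun h => hI ⟨ht, h⟩⟩
      have hev : ∀ᶠ y in 𝓝[S ∩ Ioi t] t, y < t + ε :=
        mem_nhdsWithin_of_mem_nhds (Iio_mem_nhds (by linarith))
      obtain ⟨y, hy, hyS, hty⟩ := (hev.and self_mem_nhdsWithin).exists
      obtain ⟨x, hx, hxD⟩ := mem_closure_iff.1 (hD hyS) (Ioo t (t + ε)) isOpen_Ioo ⟨hty, hy⟩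
      exact ⟨x, Or.inl hxD, hx.1.le, hx.2⟩
  have hsub : D ∪ I ⊆ S := union_subset hDS fun x hx => hx.1
  have hne : (D ∪ I).Nonempty := by
    obtain ⟨t, ht⟩ := hS
    obtain ⟨x, hx, -⟩ := key t ht 1 one_pos
    exact ⟨x, hx⟩
  obtain ⟨f, hf⟩ := (hDc.union hIc).exists_eq_range hne
  refine ⟨fun m => ⟨f m, hsub (hf ▸ mem_range_self m)⟩, fun t ht ε hε => ?_⟩
  obtain ⟨x, hx, h⟩ := key t ht ε hε
  rw [hf] at hx
  obtain ⟨m, rfl⟩ := hx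
  exact ⟨m, h⟩

theorem exists_monotone_cofinal_seq {S : Set ℝ} (hS : S.Nonempty) :
    ∃ u : ℕ → S, Monotone u ∧ ∀ x ∈ S, ∃ n, x ≤ (u n : ℝ) := by
  obtain ⟨d, hd⟩ := exists_seq_dense_right hS
  refine ⟨partialSups d, (partialSups d).monotone, fun x hx => ?_⟩
  obtain ⟨m, hm, -⟩ := hd x hx 1 one_pos
  exact ⟨m, hm.trans (le_partialSups d m)⟩

/-- Evaluation of a function at a point is not measurable in the pair when the index set is
uncountable; on right-continuous functions it nevertheless agrees with a measurable map. -/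
theorem exists_measurable_eval {Λ : Set ℝ} (hΛ : Λ.Nonempty) :
    ∃ g : ℝ × (Λ → ℝ) → ℝ, Measurable g ∧ ∀ t ∈ Λ, ∀ f : ℝ → ℝ,
      ContinuousWithinAt f (Λ ∩ Ici t) t → g (t, fun s => f s) = f t := by
  classical
  obtain ⟨d, hd⟩ := exists_seq_dense_right hΛ
  -- `P k x m` says that `d m` approximates `x` from the right up to `1 / (k + 1)`; the second
  -- alternative makes `Nat.find` applicable at points `x` without such an approximation.
  let A : ℕ → ℝ → ℕ → Prop := fun k x m => x ≤ d m ∧ (d m : ℝ) < x + 1 / ((k : ℝ) + 1)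
  let P : ℕ → ℝ → ℕ → Prop := fun k x m => A k x m ∨ ∀ j, ¬ A k x j
  have hA : ∀ k m, MeasurableSet {x | A k x m} := fun k m =>
    (measurableSet_le measurable_id measurable_const).inter
      (measurableSet_lt measurable_const (measurable_id.add_const _))
  have hP : ∀ k m, MeasurableSet {x | P k x m} := fun k m =>
    (hA k m).union <| by
      change MeasurableSet {x | ∀ j, ¬ A k x j}
      simp only [ofPred_forall]
      exact MeasurableSet.iInter fun j => (hA k j).compl
  have hex : ∀ k x, ∃ m, P k x m := by
    intro k x
    by_cases h : ∃ m, A k x m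
    · exact h.imp fun m hm => Or.inl hm
    · exact ⟨0, Or.inr (not_exists.1 h)⟩
  let N : ℕ → ℝ → ℕ := fun k x => Nat.find (hex k x)
  have hN : ∀ k, Measurable (N k) := fun k => measurable_find (hex k) (hP k)
  have hev : Measurable fun p : ℕ × (Λ → ℝ) => p.2 (d p.1) :=
    measurable_from_prod_countable_right fun m => measurable_pi_apply (d m)
  refine ⟨fun p => limsup (fun k => p.2 (d (N k p.1))) atTop, ?_, fun t ht f hf => ?_⟩
  · exact Measurable.limsup fun k =>
      hev.comp (((hN k).comp measurable_fst).prodMk measurable_snd)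
  · have hAN : ∀ k, A k t (N k t) := by
      intro k
      obtain ⟨m, hm⟩ := hd t ht (1 / ((k : ℝ) + 1)) (by positivity)
      exact (Nat.find_spec (hex k t)).resolve_right fun h => h m hm
    have hlim : Tendsto (fun k => (d (N k t) : ℝ)) atTop (𝓝[Λ ∩ Ici t] t) := by
      refine tendsto_nhdsWithin_iff.2 ⟨?_, Eventually.of_forall fun k => ⟨(d _).2, (hAN k).1⟩⟩
      have h1 : Tendsto (fun k : ℕ => t + 1 / ((k : ℝ) + 1)) atTop (𝓝 t) := by
        simpa using tendsto_one_div_add_atTop_nhds_zero_nat.const_add t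
      exact tendsto_of_tendsto_of_tendsto_of_le_of_le tendsto_const_nhds h1
        (fun k => (hAN k).1) fun k => (hAN k).2.le
    exact (hf.tendsto.comp hlim).limsup_eq

/-- A right-continuous function is bounded above on `Λ ∩ Ici t` as soon as it is bounded above on
the members of a right-dense sequence in this set. -/
theorem le_of_forall_dense_right {Λ : Set ℝ} {d : ℕ → Λ}
    (hd : ∀ t ∈ Λ, ∀ ε > 0, ∃ m, t ≤ (d m : ℝ) ∧ (d m : ℝ) < t + ε) {f : ℝ → ℝ} {a t : ℝ}
    (ht : t ∈ Λ) (hf : ContinuousWithinAt f (Λ ∩ Ici t) t)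
    (h : ∀ m, t ≤ (d m : ℝ) → f (d m) ≤ a) : f t ≤ a := by
  by_contra! hlt
  have hev := hf.eventually (lt_mem_nhds hlt)
  obtain ⟨ε, hε, hball⟩ := Metric.mem_nhdsWithin_iff.1 hev
  obtain ⟨m, hm, hm'⟩ := hd t ht ε hε
  have : a < f (d m) := hball ⟨by
    rw [Metric.mem_ball, Real.dist_eq, abs_of_nonneg (by linarith)]; linarith, (d m).2, hm⟩
  exact (h m hm).not_gt this

/-! ### The threshold of a fixed realization of the losses -/

section Pathwise

variable {Ω : Type*} {Λ : Set ℝ} {L : ℕ → ℝ → Ω → ℝ} {α b B : ℝ} {n : ℕ} {ω : Ω}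

theorem continuousWithinAt_empRisk {s : Set ℝ} {t : ℝ}
    (hL : ∀ i, ContinuousWithinAt (fun s => L i s ω) s t) :
    ContinuousWithinAt (fun s => empRisk L n s ω) s t := by
  unfold empRisk
  exact (tendsto_finsetSum _ fun i _ => hL i).div_const _

theorem bddAbove_empRisk_image (hL : ∀ i, ∀ t ∈ Λ, L i t ω ≤ B) (s : ℝ) :
    BddAbove ((fun t => empRisk L n t ω) '' (Λ ∩ Ici s)) := by
  refine ⟨(∑ _i ∈ Finset.range n, B) / n, ?_⟩
  rintro _ ⟨t, ht, rfl⟩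
  simp only [empRisk]
  gcongr with i _
  exact hL i t ht.1

theorem mem_feasible_iff (hL : ∀ i, ∀ t ∈ Λ, L i t ω ≤ B) {s : ℝ} :
    s ∈ feasible Λ L α n ω ↔ s ∈ Λ ∧ ∀ t ∈ Λ, s ≤ t → empRisk L n t ω ≤ α := by
  refine and_congr_right fun hs => ⟨fun h t ht hst => ?_, fun h => ?_⟩
  · exact (le_csSup (bddAbove_empRisk_image hL s) ⟨t, ⟨ht, hst⟩, rfl⟩).trans h
  · refine csSup_le ⟨_, s, ⟨hs, self_mem_Ici⟩, rfl⟩ ?_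
    rintro _ ⟨t, ht, rfl⟩
    exact h t ht.1 ht.2

/-- The empirical risk is controlled at the threshold itself, even when the infimum defining the
threshold is not attained, because the losses are right-continuous. -/
theorem empRisk_le_of_threshold_le (hL : ∀ i, ∀ t ∈ Λ, L i t ω ≤ B)
    (hc : ∀ i, ∀ t ∈ Λ, ContinuousWithinAt (fun s => L i s ω) (Λ ∩ Ici t) t)
    (hw : ThresholdWellDefined Λ L α n ω) {t : ℝ} (ht : t ∈ Λ)
    (hle : threshold Λ L α n ω ≤ t) : empRisk L n t ω ≤ α := by
  obtain ⟨hne, -, -⟩ := hw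
  have habove : ∀ s ∈ Λ, threshold Λ L α n ω < s → empRisk L n s ω ≤ α := by
    intro s hs hlt
    obtain ⟨r, hr, hrs⟩ := exists_lt_of_csInf_lt hne hlt
    exact ((mem_feasible_iff hL).1 hr).2 s hs hrs.le
  rcases hle.lt_or_eq with hlt | heq
  · exact habove t ht hlt
  by_cases hmem : t ∈ feasible Λ L α n ω
  · exact ((mem_feasible_iff hL).1 hmem).2 t ht le_rfl
  -- The threshold is not attained, hence it is a limit from the right of feasible parameters.
  by_contra! hgt
  have hev := (continuousWithinAt_empRisk (n := n) fun i => hc i t ht).eventually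
    (lt_mem_nhds hgt)
  obtain ⟨ε, hε, hball⟩ := Metric.mem_nhdsWithin_iff.1 hev
  obtain ⟨r, hr, hrt⟩ := exists_lt_of_csInf_lt hne
    (show sInf (feasible Λ L α n ω) < t + ε by rw [← heq]; simpa [threshold] using hε)
  have hrΛ : r ∈ Λ := hr.1
  by_cases htr : t < r
  · have : α < empRisk L n r ω := hball ⟨by
      rw [Metric.mem_ball, Real.dist_eq, abs_of_pos (by linarith)]; linarith, hrΛ, htr.le⟩
    exact this.not_ge (habove r hrΛ (heq ▸ htr))
  · exact hgt.not_ge (((mem_feasible_iff hL).1 hr).2 t ht (not_lt.1 htr))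

/-- On right-continuous bounded losses the threshold is a measurable function of the calibration
losses: by right-continuity only countably many parameters matter. -/
theorem exists_measurable_threshold (hΛ : Λ.Nonempty) (L : ℕ → ℝ → Ω → ℝ) (α : ℝ) (n : ℕ) :
    ∃ φ : (Finset.range n → Λ → ℝ) → ℝ, Measurable φ ∧ ∀ ω, ∀ B,
      (∀ i, ∀ t ∈ Λ, L i t ω ≤ B) →
      (∀ i, ∀ t ∈ Λ, ContinuousWithinAt (fun s => L i s ω) (Λ ∩ Ici t) t) →
      ThresholdWellDefined Λ L α n ω →
      threshold Λ L α n ω = φ fun i t => L i t ω := by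
  classical
  obtain ⟨d, hd⟩ := exists_seq_dense_right hΛ
  let G : ℕ → (Finset.range n → Λ → ℝ) → Prop := fun m x =>
    ∀ j, (d m : ℝ) ≤ d j → (∑ i, x i (d j)) / n ≤ α
  have hG : ∀ m, MeasurableSet {x | G m x} := by
    intro m
    simp only [G, ofPred_forall]
    refine MeasurableSet.iInter fun j => MeasurableSet.iInter fun _ =>
      measurableSet_le ?_ measurable_const
    exact (Finset.measurable_fun_sum _ fun i _ =>
      (measurable_pi_apply (d j)).comp (measurable_pi_apply i)).div_const _
  refine ⟨fun x => (⨅ m, if G m x then ((d m : ℝ) : EReal) else ⊤).toReal, ?_, ?_⟩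
  · exact (Measurable.iInf fun m =>
      Measurable.ite (hG m) measurable_const measurable_const).ereal_toReal
  intro ω B hL hc hw
  have hGm : ∀ m, G m (fun i t => L i t ω) ↔ (d m : ℝ) ∈ feasible Λ L α n ω := by
    intro m
    have hsum : ∀ j, (∑ i : Finset.range n, L i (d j) ω) / n = empRisk L n (d j) ω := by
      intro j
      rw [empRisk, ← Finset.sum_coe_sort (Finset.range n) fun i => L i (d j) ω]
    simp only [G, hsum, mem_feasible_iff hL]
    refine ⟨fun h => ⟨(d m).2, fun t ht hmt => ?_⟩, fun h j hj => h.2 _ (d j).2 hj⟩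
    exact le_of_forall_dense_right (f := fun t => empRisk L n t ω) hd ht
      (continuousWithinAt_empRisk fun i => hc i t ht) fun j hj => h j (hmt.trans hj)
  suffices h : (⨅ m, if G m (fun i t => L i t ω) then ((d m : ℝ) : EReal) else ⊤) =
      (threshold Λ L α n ω : EReal) by simp only [h, EReal.toReal_coe]
  obtain ⟨hne, hbelow, -⟩ := hw
  apply le_antisymm
  · refine EReal.le_of_forall_lt_iff_le.1 fun c hcT => ?_
    obtain ⟨s, hs, hsc⟩ := exists_lt_of_csInf_lt hne (EReal.coe_lt_coe_iff.1 hcT)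
    obtain ⟨m, hsm, hmc⟩ := hd s hs.1 (c - s) (by linarith)
    have hm : G m (fun i t => L i t ω) := by
      rw [hGm, mem_feasible_iff hL]
      exact ⟨(d m).2, fun t ht hmt => ((mem_feasible_iff hL).1 hs).2 t ht (hsm.trans hmt)⟩
    refine (iInf_le _ m).trans ?_
    rw [if_pos hm]
    exact EReal.coe_le_coe_iff.2 (by linarith)
  · refine le_iInf fun m => ?_
    split_ifs with hm
    · exact EReal.coe_le_coe_iff.2 (csInf_le hbelow ((hGm m).1 hm))
    · exact le_top

end Pathwise

/-! ### Expectation and tail bounds for the threshold -/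

section Probability

variable {Ω : Type*} [MeasurableSpace Ω] {μ : Measure Ω} [IsProbabilityMeasure μ]
  {Λ : Set ℝ} {α b B : ℝ}

/-- Fubini's theorem for the evaluation of a right-continuous random function `F` at an independent
random point `τ`. Neither measurability of the index set `Λ` nor joint measurability of `F` is
needed, since the evaluation agrees almost surely with a measurable map. -/
theorem integral_eval_of_indepFun {F : ℝ → Ω → ℝ} {τ : Ω → ℝ} (hτ : Measurable τ)
    (hF : ∀ t ∈ Λ, Measurable (F t)) (hind : IndepFun τ (fun ω (t : Λ) => F t ω) μ)
    (hτΛ : ∀ᵐ ω ∂μ, τ ω ∈ Λ)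
    (hright : ∀ᵐ ω ∂μ, ∀ t ∈ Λ, ContinuousWithinAt (fun s => F s ω) (Λ ∩ Ici t) t)
    (hbdd : ∀ᵐ ω ∂μ, ∀ t ∈ Λ, b ≤ F t ω ∧ F t ω ≤ B) :
    Integrable (fun ω => F (τ ω) ω) μ ∧ Integrable (fun ω => ∫ ω', F (τ ω) ω' ∂μ) μ ∧
      ∫ ω, F (τ ω) ω ∂μ = ∫ ω, ∫ ω', F (τ ω) ω' ∂μ ∂μ := by
  have hΛ : Λ.Nonempty := hτΛ.exists.elim fun ω h => ⟨_, h⟩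
  obtain ⟨g, hg, hgF⟩ := exists_measurable_eval hΛ
  set Y : Ω → Λ → ℝ := fun ω t => F t ω
  have hY : Measurable Y := measurable_pi_lambda _ fun t => hF t t.2
  have hτY : Measurable fun ω => (τ ω, Y ω) := hτ.prodMk hY
  have hae : (fun ω => g (τ ω, Y ω)) =ᵐ[μ] fun ω => F (τ ω) ω := by
    filter_upwards [hτΛ, hright] with ω h1 h2
    exact hgF _ h1 (fun s => F s ω) (h2 _ h1)
  have hint : Integrable (fun ω => g (τ ω, Y ω)) μ := by
    refine Integrable.of_mem_Icc b B (hg.comp hτY).aemeasurable ?_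
    filter_upwards [hae, hτΛ, hbdd] with ω h1 h2 h3
    rw [h1]
    exact h3 _ h2
  have hlaw : μ.map (fun ω => (τ ω, Y ω)) = (μ.map τ).prod (μ.map Y) :=
    (indepFun_iff_map_prod_eq_prod_map_map hτ.aemeasurable hY.aemeasurable).1 hind
  have : IsProbabilityMeasure (μ.map τ) := Measure.isProbabilityMeasure_map hτ.aemeasurable
  have : IsProbabilityMeasure (μ.map Y) := Measure.isProbabilityMeasure_map hY.aemeasurable
  have hintp : Integrable g ((μ.map τ).prod (μ.map Y)) := by
    rw [← hlaw]
    exact (integrable_map_measure hg.aestronglyMeasurable hτY.aemeasurable).2 hint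
  have hinner : (fun ω => ∫ y, g (τ ω, y) ∂(μ.map Y)) =ᵐ[μ] fun ω => ∫ ω', F (τ ω) ω' ∂μ := by
    filter_upwards [hτΛ] with ω hω
    have hgω : Measurable fun y => g (τ ω, y) := hg.comp measurable_prodMk_left
    rw [integral_map hY.aemeasurable hgω.aestronglyMeasurable]
    refine integral_congr_ae ?_
    filter_upwards [hright] with ω' h'
    exact hgF _ hω (fun s => F s ω') (h' _ hω)
  have hmeas : AEStronglyMeasurable (fun x => ∫ y, g (x, y) ∂(μ.map Y)) (μ.map τ) :=
    hintp.integral_prod_left.aestronglyMeasurable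
  refine ⟨hint.congr hae, ?_, ?_⟩
  · exact ((integrable_map_measure hmeas hτ.aemeasurable).1 hintp.integral_prod_left).congr hinner
  · calc ∫ ω, F (τ ω) ω ∂μ = ∫ ω, g (τ ω, Y ω) ∂μ := (integral_congr_ae hae).symm
      _ = ∫ p, g p ∂((μ.map τ).prod (μ.map Y)) := by
        rw [← hlaw, integral_map hτY.aemeasurable hg.aestronglyMeasurable]
      _ = ∫ x, ∫ y, g (x, y) ∂(μ.map Y) ∂(μ.map τ) := integral_prod _ hintp
      _ = ∫ ω, ∫ y, g (τ ω, y) ∂(μ.map Y) ∂μ := integral_map hτ.aemeasurable hmeas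
      _ = ∫ ω, ∫ ω', F (τ ω) ω' ∂μ ∂μ := integral_congr_ae hinner

/-- Chebyshev's inequality for the lower tail of an average of bounded independent variables. -/
theorem measure_average_le_le {X : ℕ → Ω → ℝ} {m ε : ℝ} {n : ℕ} (hX : ∀ i, Measurable (X i))
    (hind : Pairwise fun i j => IndepFun (X i) (X j) μ)
    (hbdd : ∀ i, ∀ᵐ ω ∂μ, X i ω ∈ Icc b B) (hmean : ∀ i, ∫ ω, X i ω ∂μ = m)
    (hε : 0 < ε) (hm : α + ε ≤ m) (hn : 0 < n) :
    μ {ω | (∑ i ∈ Finset.range n, X i ω) / n ≤ α} ≤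
      ENNReal.ofReal (((B - b) / 2) ^ 2 / ε ^ 2 / n) := by
  have hn' : (0 : ℝ) < n := Nat.cast_pos.2 hn
  have hLp : ∀ i, MemLp (X i) 2 μ := fun i =>
    memLp_of_bounded (hbdd i) (hX i).aestronglyMeasurable 2
  have hLpS : MemLp (∑ i ∈ Finset.range n, X i) 2 μ := memLp_finsetSum' _ fun i _ => hLp i
  have hES : ∫ ω, (∑ i ∈ Finset.range n, X i) ω ∂μ = n * m := by
    simp only [Finset.sum_apply]
    rw [integral_finsetSum _ fun i _ => (hLp i).integrable (by norm_num)]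
    simp [hmean]
  have hVar : variance (∑ i ∈ Finset.range n, X i) μ ≤ n * ((B - b) / 2) ^ 2 := by
    rw [IndepFun.variance_sum (fun i _ => hLp i) fun i _ j _ hij => hind hij]
    calc _ ≤ ∑ _i ∈ Finset.range n, ((B - b) / 2) ^ 2 :=
          Finset.sum_le_sum fun i _ => variance_le_sq_of_bounded (hbdd i) (hX i).aemeasurable
      _ = _ := by simp
  calc μ {ω | (∑ i ∈ Finset.range n, X i ω) / n ≤ α}
      ≤ μ {ω | n * ε ≤ |(∑ i ∈ Finset.range n, X i) ω -
          ∫ ω, (∑ i ∈ Finset.range n, X i) ω ∂μ|} := by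
        refine measure_mono fun ω hω => ?_
        have hω' : ∑ i ∈ Finset.range n, X i ω ≤ α * n := (div_le_iff₀ hn').1 hω
        change n * ε ≤ |_|
        rw [hES, Finset.sum_apply]
        refine le_trans ?_ (neg_le_abs _)
        nlinarith
    _ ≤ ENNReal.ofReal (variance (∑ i ∈ Finset.range n, X i) μ / (n * ε) ^ 2) :=
        meas_ge_le_variance_div_sq hLpS (by positivity)
    _ ≤ _ := by
        refine ENNReal.ofReal_le_ofReal ?_
        calc _ ≤ n * ((B - b) / 2) ^ 2 / (n * ε) ^ 2 := by gcongr
          _ = _ := by field_simp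

/-- The threshold rarely selects a parameter of large risk. No uniform law of large numbers over
`Λ` is available; instead, along a sequence increasing to the end of the set of parameters of large
risk, the empirical risk is eventually at most `α` whenever the threshold lies in that set, and
Chebyshev's bound does not depend on the member of the sequence. -/
theorem measure_threshold_risky_le {L : ℕ → ℝ → Ω → ℝ} {R : ℝ → ℝ} {ε : ℝ} {n : ℕ}
    (hmeas : ∀ i, ∀ t ∈ Λ, Measurable (L i t))
    (hind : ∀ t ∈ Λ, Pairwise fun i j => IndepFun (L i t) (L j t) μ)
    (hmean : ∀ i, ∀ t ∈ Λ, ∫ ω, L i t ω ∂μ = R t)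
    (hright : ∀ i, ∀ᵐ ω ∂μ, ∀ t ∈ Λ, ContinuousWithinAt (fun s => L i s ω) (Λ ∩ Ici t) t)
    (hbdd : ∀ i, ∀ᵐ ω ∂μ, ∀ t ∈ Λ, b ≤ L i t ω ∧ L i t ω ≤ B)
    (hwell : ∀ᵐ ω ∂μ, ThresholdWellDefined Λ L α n ω) (hε : 0 < ε) (hn : 0 < n) :
    μ {ω | α + ε < R (threshold Λ L α n ω)} ≤
      ENNReal.ofReal (((B - b) / 2) ^ 2 / ε ^ 2 / n) := by
  set S : Set ℝ := {t | t ∈ Λ ∧ α + ε < R t}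
  rcases S.eq_empty_or_nonempty with hS | hS
  · have h0 : μ {ω | α + ε < R (threshold Λ L α n ω)} = 0 := by
      refine measure_eq_zero_iff_ae_notMem.2 ?_
      filter_upwards [hwell] with ω hw hω
      exact hS.subset (⟨hw.2.2, hω⟩ : threshold Λ L α n ω ∈ S)
    simp [h0]
  obtain ⟨u, hu, hcof⟩ := exists_monotone_cofinal_seq hS
  let E : ℕ → Set Ω := fun k => {ω | threshold Λ L α n ω ≤ u k}
  have hE : Monotone E := fun k l hkl ω hω =>
    le_trans (show threshold Λ L α n ω ≤ u k from hω) (hu hkl)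
  let W : Set Ω := {ω | α + ε < R (threshold Λ L α n ω)}
  calc μ W ≤ μ (⋃ k, W ∩ E k) := by
        refine measure_mono_ae ?_
        filter_upwards [hwell] with ω hw hω
        obtain ⟨k, hk⟩ := hcof _ (⟨hw.2.2, hω⟩ : threshold Λ L α n ω ∈ S)
        exact mem_iUnion.2 ⟨k, hω, hk⟩
    _ = ⨆ k, μ (W ∩ E k) :=
        Monotone.measure_iUnion fun k l hkl => inter_subset_inter_right _ (hE hkl)
    _ ≤ _ := by
        refine iSup_le fun k => ?_
        have huΛ : (u k : ℝ) ∈ Λ := (u k).2.1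
        calc μ (W ∩ E k) ≤ μ {ω | (∑ i ∈ Finset.range n, L i (u k) ω) / n ≤ α} := by
              refine measure_mono_ae ?_
              filter_upwards [ae_all_iff.2 hright, ae_all_iff.2 hbdd, hwell] with ω h1 h2 h3 hω
              exact empRisk_le_of_threshold_le (fun i t ht => (h2 i t ht).2) h1 h3 huΛ hω.2
          _ ≤ _ := measure_average_le_le (fun i => hmeas i _ huΛ) (hind _ huΛ)
              (fun i => (hbdd i).mono fun ω h => h _ huΛ) (fun i => hmean i _ huΛ) hε
              (u k).2.2.le hn

/-- A random variable bounded by `B` which exceeds `a` with probability at most `δ` has expectation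
at most `a + |B - a| * δ`. -/
theorem integral_le_add_of_measure_lt_le {X : Ω → ℝ} {a δ : ℝ} (hX : Integrable X μ)
    (hB : ∀ᵐ ω ∂μ, X ω ≤ B) (hδ : 0 ≤ δ) (h : μ {ω | a < X ω} ≤ ENNReal.ofReal δ) :
    ∫ ω, X ω ∂μ ≤ a + |B - a| * δ := by
  have hA : NullMeasurableSet {ω | a < X ω} μ :=
    nullMeasurableSet_lt aemeasurable_const hX.aemeasurable
  have hi : Integrable ({ω | a < X ω}.indicator fun _ => |B - a|) μ :=
    (integrable_const _).indicator₀ hA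
  calc ∫ ω, X ω ∂μ ≤ ∫ ω, (a + {ω | a < X ω}.indicator (fun _ => |B - a|) ω) ∂μ := by
        refine integral_mono_ae hX ((integrable_const a).add hi) ?_
        filter_upwards [hB] with ω hω
        by_cases hlt : a < X ω
        · rw [indicator_of_mem (show ω ∈ {ω | a < X ω} from hlt)]
          linarith [le_abs_self (B - a)]
        · rw [indicator_of_notMem (show ω ∉ {ω | a < X ω} from hlt)]
          linarith
    _ = a + |B - a| * μ.real {ω | a < X ω} := by
        rw [integral_add (integrable_const a) hi, integral_indicator₀ hA]
        simp [mul_comm]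
    _ ≤ _ := by
        gcongr
        exact ENNReal.toReal_le_of_le_ofReal hδ h

end Probability

end RiskControl

/-! ### Asymptotic control of the expected test loss -/

theorem mainTheorem6 {Ω : Type*} [MeasurableSpace Ω] (μ : Measure Ω) [IsProbabilityMeasure μ]
    (Λ : Set ℝ) (L : ℕ → ℝ → Ω → ℝ) (α : ℝ)
    (hmeas : ∀ i, ∀ t ∈ Λ, Measurable (L i t))
    (hindep : iIndepFun (fun (i : ℕ) (ω : Ω) (t : Λ) => L i t ω) μ)
    (hident : ∀ i, IdentDistrib (fun (ω : Ω) (t : Λ) => L i t ω)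
      (fun (ω : Ω) (t : Λ) => L 0 t ω) μ μ)
    (hright : ∀ i, ∀ᵐ ω ∂μ, ∀ t ∈ Λ,
      ContinuousWithinAt (fun s => L i s ω) (Λ ∩ Ici t) t)
    (hbdd : ∃ b B : ℝ, ∀ i, ∀ᵐ ω ∂μ, ∀ t ∈ Λ, b ≤ L i t ω ∧ L i t ω ≤ B)
    (hwell : ∀ᶠ n in atTop, ∀ᵐ ω ∂μ, RiskControl.ThresholdWellDefined Λ L α n ω) :
    (∀ᶠ n in atTop, Integrable (fun ω => L n (RiskControl.threshold Λ L α n ω) ω) μ) ∧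
      limsup (fun n : ℕ => ∫ ω, L n (RiskControl.threshold Λ L α n ω) ω ∂μ) atTop ≤ α := by
  open RiskControl in
  obtain ⟨b, B, hbdd⟩ := hbdd
  have hΛ : Λ.Nonempty := by
    obtain ⟨n, hn⟩ := hwell.exists
    obtain ⟨ω, hω⟩ := hn.exists
    exact ⟨_, hω.2.2⟩
  have hproc : ∀ i, Measurable fun (ω : Ω) (t : Λ) => L i t ω := fun i =>
    measurable_pi_lambda _ fun t => hmeas i t t.2
  have hmean : ∀ i, ∀ t ∈ Λ, ∫ ω, L i t ω ∂μ = ∫ ω, L 0 t ω ∂μ := fun i t ht =>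
    ((hident i).comp (measurable_pi_apply (⟨t, ht⟩ : Λ))).integral_eq
  have hind : ∀ t ∈ Λ, Pairwise fun i j => IndepFun (L i t) (L j t) μ := fun t ht i j hij =>
    (hindep.indepFun hij).comp (measurable_pi_apply (⟨t, ht⟩ : Λ))
      (measurable_pi_apply (⟨t, ht⟩ : Λ))
  have hb : ∀ i, ∀ t ∈ Λ, ∀ᵐ ω ∂μ, L i t ω ∈ Icc b B := fun i t ht =>
    (hbdd i).mono fun ω h => h t ht
  have hLint : ∀ i, ∀ t ∈ Λ, Integrable (L i t) μ := fun i t ht =>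
    Integrable.of_mem_Icc b B (hmeas i t ht).aemeasurable (hb i t ht)
  set T : ℕ → Ω → ℝ := fun n => threshold Λ L α n
  set R : ℝ → ℝ := fun t => ∫ ω, L 0 t ω ∂μ
  have hRB : ∀ t ∈ Λ, R t ≤ B := fun t ht => by
    simpa using integral_mono_ae (hLint 0 t ht) (integrable_const B)
      ((hb 0 t ht).mono fun ω h => h.2)
  -- The test loss is independent of the threshold, so that it may be replaced by its expectation.
  have hexp : ∀ n, (∀ᵐ ω ∂μ, ThresholdWellDefined Λ L α n ω) →
      Integrable (fun ω => L n (T n ω) ω) μ ∧ Integrable (fun ω => R (T n ω)) μ ∧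
        ∫ ω, L n (T n ω) ω ∂μ = ∫ ω, R (T n ω) ∂μ := by
    intro n hw
    obtain ⟨φ, hφ, hφT⟩ := exists_measurable_threshold hΛ L α n
    set τ : Ω → ℝ := fun ω => φ fun i t => L i t ω
    have hτ : Measurable τ := hφ.comp (measurable_pi_lambda _ fun i => hproc i)
    have hTτ : T n =ᵐ[μ] τ := by
      filter_upwards [ae_all_iff.2 hright, ae_all_iff.2 hbdd, hw] with ω h1 h2 h3
      exact hφT ω B (fun i t ht => (h2 i t ht).2) h1 h3
    have hindτ : IndepFun τ (fun ω (t : Λ) => L n t ω) μ :=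
      (hindep.indepFun_finset (Finset.range n) {n} (by simp) hproc).comp hφ
        (measurable_pi_apply (⟨n, Finset.mem_singleton_self n⟩ : ({n} : Finset ℕ)))
    have hτΛ : ∀ᵐ ω ∂μ, τ ω ∈ Λ := by
      filter_upwards [hTτ, hw] with ω h1 h2
      exact h1 ▸ h2.2.2
    obtain ⟨h1, h2, h3⟩ := integral_eval_of_indepFun hτ (hmeas n) hindτ hτΛ (hright n) (hbdd n)
    have e1 : (fun ω => L n (τ ω) ω) =ᵐ[μ] fun ω => L n (T n ω) ω := by
      filter_upwards [hTτ] with ω h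
      rw [h]
    have e2 : (fun ω => ∫ ω', L n (τ ω) ω' ∂μ) =ᵐ[μ] fun ω => R (T n ω) := by
      filter_upwards [hTτ, hτΛ] with ω h h'
      rw [h, hmean n _ h']
    exact ⟨h1.congr e1, h2.congr e2, by rw [← integral_congr_ae e1, h3, integral_congr_ae e2]⟩
  refine ⟨hwell.mono fun n hw => (hexp n hw).1, ?_⟩
  -- In `ℝ` the limit superior is meaningful only for a sequence that is also bounded from below.
  have hcob : IsCoboundedUnder (· ≤ ·) atTop fun n => ∫ ω, L n (T n ω) ω ∂μ := by
    refine isCoboundedUnder_le_of_eventually_le _ (x := b) ?_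
    filter_upwards [hwell] with n hw
    have : ∫ _ω, b ∂μ ≤ ∫ ω, L n (T n ω) ω ∂μ := by
      refine integral_mono_ae (integrable_const b) (hexp n hw).1 ?_
      filter_upwards [hbdd n, hw] with ω h1 h2
      exact (h1 _ h2.2.2).1
    simpa using this
  refine le_of_forall_pos_le_add fun ε hε => limsup_le_of_le hcob ?_
  have hε2 : 0 < ε / 2 := by linarith
  have hlim : Tendsto (fun n : ℕ =>
      |B - (α + ε / 2)| * (((B - b) / 2) ^ 2 / (ε / 2) ^ 2 / n)) atTop (𝓝 0) := by
    simpa using (tendsto_const_div_atTop_nhds_zero_nat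
      (((B - b) / 2) ^ 2 / (ε / 2) ^ 2)).const_mul |B - (α + ε / 2)|
  filter_upwards [hwell, eventually_gt_atTop 0, hlim.eventually (gt_mem_nhds hε2)] with n hw hn hsm
  obtain ⟨-, hRint, heq⟩ := hexp n hw
  have hle := integral_le_add_of_measure_lt_le hRint (hw.mono fun ω h => hRB _ h.2.2)
    (by positivity) (measure_threshold_risky_le hmeas hind hmean hright hbdd hw hε2 hn)
  rw [heq]
  linarith
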